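/- Let $n\ge 3$, let $W=\mathbb C^n\setminus\{0\}$, and let $f(z_1,\dots,z_n)=(\mu_1z_1,\dots,\mu_nz_n)$ be a diagonal contraction with $0<|\mu_1|\le|\mu_2|\le\dots\le|\mu_n|<1$. Assume that the Hopf manifold $X=W/\langle f\rangle$ is generic, i.e. there is no nontrivial relation $$\prod_{i\in A}\mu_i^{r_i}=\prod_{j\in B}\mu_j^{r_j},\qquad r_i,r_j\in\mathbb N=\{0,1,2,\dots\},\quad A\cap B=\emptyset,\quad A\cup B=\{1,\dots,n\}$$ (nontrivial meaning that not all exponents vanish). For $b\in\mathbb C^*$ let $L_b$ be the holomorphic line bundle on $X$ obtained as the quotient of $W\times\mathbb C$ by $(z,v)\mapsto(f(z),bv)$. A one-dimensional holomorphic foliation on $X$, possibly singular, is given by a line bundle $T_{\mathcal F}=L_b$ and a holomorphic morphism of vector bundles $T_{\mathcal F}\to TX$ that is not identically zero. Then every one-dimensional holomorphic foliation $\mathcal F$ on $X$, possibly singular, is induced by a monomial vector field: there are $d=(d_1,\dots,d_n)\in\mathbb Z^n$ and constants $(c^1,\dots,c^n)\in\mathbb C^n\setminus\{0\}$ such that,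 for every $k$ with $c^k\neq0$, all exponents of the monomial $z^dz_k=z_1^{d_1}\cdots z_k^{d_k+1}\cdots z_n^{d_n}$ are nonnegative, and $\mathcal F$ is induced by the vector field $$V=\sum_{k=1}^n c^k\,z^d z_k\,\frac{\partial}{\partial z_k}$$ on $W$ (terms with $c^k=0$ being zero); that is, with $\pi:W\to X$ the projection, the morphism $L_b\to TX$ sends the class $[z,v]$ to $v\,d\pi_z(V(z))$ for all $z\in W$, $v\in\mathbb C$. -/

import Mathlib

open scoped Manifold ContDiff Topology
open Bundle Set

noncomputable section

namespace HopfFoliation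

/-! ### Quotient of a manifold by the infinite cyclic group generated by an automorphism -/

section CyclicQuotient

variable {M : Type*} [TopologicalSpace M]

/-- Two points are equivalent if they lie in the same orbit of `⟨f⟩`. -/
def orbitSetoid (f : M ≃ₜ M) : Setoid M where
  r x y := ∃ k : ℤ, (f ^ k) x = y
  iseqv :=
    { refl := fun x => ⟨0, by simp⟩
      symm := by
        rintro x y ⟨k, rfl⟩
        exact ⟨-k, by rw [← Homeomorph.mul_apply, ← zpow_add]; simp⟩
      trans := by
        rintro x y z ⟨k, rfl⟩ ⟨l, rfl⟩
        exact ⟨l + k, by rw [← Homeomorph.mul_apply, ← zpow_add]⟩ }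

/-- The orbit space `M / ⟨f⟩`, with the quotient topology. -/
def CyclicQuotient (f : M ≃ₜ M) : Type _ := Quotient (orbitSetoid f)

instance (f : M ≃ₜ M) : TopologicalSpace (CyclicQuotient f) :=
  inferInstanceAs (TopologicalSpace (Quotient (orbitSetoid f)))

/-- The canonical projection `M → M / ⟨f⟩`. -/
def CyclicQuotient.mk (f : M ≃ₜ M) (x : M) : CyclicQuotient f := Quotient.mk (orbitSetoid f) x

/-- The group `⟨f⟩` is infinite cyclic and acts freely, every point having a neighbourhood which is
disjoint from all its nontrivial translates. -/
class IsCoveringAction (f : M ≃ₜ M) : Prop where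
  exists_nhds : ∀ p : M, ∃ U : Set M, IsOpen U ∧ p ∈ U ∧
    ∀ (k : ℤ), ∀ x ∈ U, (f ^ k) x ∈ U → k = 0

namespace CyclicQuotient

theorem mk_surjective (f : M ≃ₜ M) : Function.Surjective (mk f) := Quotient.mk_surjective

theorem mk_eq_mk_iff (f : M ≃ₜ M) {x y : M} : mk f x = mk f y ↔ ∃ k : ℤ, (f ^ k) x = y :=
  Quotient.eq (r := orbitSetoid f)

theorem continuous_mk (f : M ≃ₜ M) : Continuous (mk f) := continuous_quot_mk

theorem isOpenMap_mk (f : M ≃ₜ M) : IsOpenMap (mk f) := by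
  intro U hU
  have h : mk f ⁻¹' (mk f '' U) = ⋃ k : ℤ, (f ^ k) ⁻¹' U := by
    ext y
    simp only [mem_preimage, mem_image, mem_iUnion]
    constructor
    · rintro ⟨x, hx, hxy⟩
      obtain ⟨k, hk⟩ := (mk_eq_mk_iff f).1 hxy.symm
      exact ⟨k, hk ▸ hx⟩
    · rintro ⟨k, hk⟩
      exact ⟨_, hk, ((mk_eq_mk_iff f).2 ⟨k, rfl⟩).symm⟩
  have h2 : IsOpen (mk f ⁻¹' (mk f '' U)) := by
    rw [h]
    exact isOpen_iUnion fun k => hU.preimage (f ^ k).continuous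
  exact h2

theorem isLocalHomeomorph_mk (f : M ≃ₜ M) [hf : IsCoveringAction f] :
    IsLocalHomeomorph (mk f) := by
  rw [isLocalHomeomorph_iff_isOpenEmbedding_restrict]
  intro p
  obtain ⟨U, hU, hp, h⟩ := hf.exists_nhds p
  refine ⟨U, hU.mem_nhds hp, ?_⟩
  refine Topology.IsOpenEmbedding.of_continuous_injective_isOpenMap
    ((continuous_mk f).comp continuous_subtype_val) ?_
    ((isOpenMap_mk f).comp hU.isOpenMap_subtype_val)
  rintro ⟨x, hx⟩ ⟨y, hy⟩ hxy
  obtain ⟨k, hk⟩ := (mk_eq_mk_iff f).1 hxy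
  have hk0 : k = 0 := h k x hx (by rw [hk]; exact hy)
  subst hk0
  exact Subtype.ext (by simpa using hk)

variable {H : Type*} [TopologicalSpace H] [ChartedSpace H M]

/-- The charts of `M / ⟨f⟩` are the local inverses of the projection followed by charts of `M`. -/
instance (f : M ≃ₜ M) [IsCoveringAction f] : ChartedSpace H (CyclicQuotient f) :=
  (isLocalHomeomorph_mk f).chartedSpace (mk_surjective f)

end CyclicQuotient

/-- `f` is an automorphism of the complex manifold `M`: it and its inverse are holomorphic. -/
class IsBiholomorphic {E H : Type*} [NormedAddCommGroup E] [NormedSpace ℂ E] [TopologicalSpace H]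
    [ChartedSpace H M] (I : ModelWithCorners ℂ E H) (f : M ≃ₜ M) : Prop where
  contMDiff : ContMDiff I I ω f
  contMDiff_symm : ContMDiff I I ω f.symm

namespace CyclicQuotient

variable {E H : Type*} [NormedAddCommGroup E] [NormedSpace ℂ E] [TopologicalSpace H]
  [ChartedSpace H M] (I : ModelWithCorners ℂ E H)

theorem contMDiff_zpow (f : M ≃ₜ M) [hf : IsBiholomorphic I f] (k : ℤ) :
    ContMDiff I I ω (f ^ k : M ≃ₜ M) := by
  have hp : ∀ (g : M ≃ₜ M), ContMDiff I I ω g → ∀ m : ℕ, ContMDiff I I ω (g ^ m : M ≃ₜ M) := by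
    intro g hg m
    induction m with
    | zero => exact (contMDiff_id : ContMDiff I I ω (id : M → M))
    | succ m ih => rw [pow_succ]; exact ih.comp hg
  obtain ⟨m, rfl | rfl⟩ := k.eq_nat_or_neg
  · rw [zpow_natCast]; exact hp f hf.contMDiff m
  · rw [zpow_neg, zpow_natCast, ← inv_pow]; exact hp f⁻¹ hf.contMDiff_symm m

/-- `M / ⟨f⟩` is a complex manifold. -/
instance (f : M ≃ₜ M) [IsCoveringAction f] [IsBiholomorphic I f] [IsManifold I ω M] :
    IsManifold I ω (CyclicQuotient f) := by
  refine isManifold_of_contDiffOn I ω _ ?_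
  rintro _ _ ⟨q, rfl⟩ ⟨q', rfl⟩
  rw [← contMDiffOn_iff_contDiffOn]
  set hl := isLocalHomeomorph_mk f
  generalize ((mk_surjective f).hasRightInverse.choose q) = a
  generalize ((mk_surjective f).hasRightInverse.choose q') = a'
  set l := hl.localInverseAt a
  set l' := hl.localInverseAt a'
  set c := chartAt H a
  set c' := chartAt H a'
  have key : ContMDiffOn I I ω ((l.trans c).symm.trans (l'.trans c'))
      ((l.trans c).symm.trans (l'.trans c')).source := by
    intro x hx
    simp only [OpenPartialHomeomorph.trans_source, OpenPartialHomeomorph.symm_source,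
      OpenPartialHomeomorph.trans_target, OpenPartialHomeomorph.coe_trans_symm, mem_inter_iff,
      mem_preimage, Function.comp_apply, hl.localInverseAt_symm, l] at hx
    obtain ⟨⟨hxc, hxl⟩, hxl', hxc'⟩ := hx
    obtain ⟨k, hk⟩ := (mk_eq_mk_iff f).1 (hl.apply_localInverseAt_of_mem hxl').symm
    have hc : ContMDiffAt I I ω c.symm x :=
      contMDiffOn_chart_symm.contMDiffAt (c.open_target.mem_nhds hxc)
    have hfk : ContMDiffAt I I ω (f ^ k : M ≃ₜ M) (c.symm x) := contMDiff_zpow I f k _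
    have hc' : ContMDiffAt I I ω c' ((f ^ k : M ≃ₜ M) (c.symm x)) :=
      contMDiffOn_chart.contMDiffAt (c'.open_source.mem_nhds (by rw [hk]; exact hxc'))
    refine ((hc'.comp x (hfk.comp x hc)).congr_of_eventuallyEq ?_).contMDiffWithinAt
    have ht : ∀ᶠ y in 𝓝 x, (f ^ k : M ≃ₜ M) (c.symm y) ∈ l'.target :=
      (hfk.comp x hc).continuousAt.preimage_mem_nhds (l'.open_target.mem_nhds (by
        change (f ^ k : M ≃ₜ M) (c.symm x) ∈ _
        rw [hk]; exact l'.map_source hxl'))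
    have hs : ∀ᶠ y in 𝓝 x, mk f (c.symm y) ∈ l'.source :=
      ((continuous_mk f).continuousAt.comp hc.continuousAt).preimage_mem_nhds
        (l'.open_source.mem_nhds hxl')
    filter_upwards [ht, hs] with y hy hy'
    have hly : l' (mk f (c.symm y)) = (f ^ k : M ≃ₜ M) (c.symm y) := by
      refine hl.injOn_localInverseAt_target (l'.map_source hy') hy ?_
      rw [hl.apply_localInverseAt_of_mem hy']
      exact (mk_eq_mk_iff f).2 ⟨k, rfl⟩
    simp only [OpenPartialHomeomorph.coe_trans, OpenPartialHomeomorph.coe_trans_symm,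
      Function.comp_apply, hl.localInverseAt_symm, l, hly]
  refine I.contMDiff.comp_contMDiffOn (key.comp (I.contMDiffOn_symm.mono inter_subset_right) ?_)
  exact fun y hy => hy.1

end CyclicQuotient

end CyclicQuotient

/-! ### Hopf manifolds -/

/-- The multipliers of a diagonal contraction `(z₁, …, zₙ) ↦ (μ₁ z₁, …, μₙ zₙ)` of `ℂⁿ`. -/
structure HopfData (n : ℕ) where
  μ : Fin n → ℂ
  norm_pos : ∀ i, 0 < ‖μ i‖
  norm_lt_one : ∀ i, ‖μ i‖ < 1

/-- The complex manifold `W = ℂⁿ \ {0}`. -/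
abbrev PuncturedSpace (n : ℕ) : TopologicalSpace.Opens (Fin n → ℂ) := ⟨{0}ᶜ, isOpen_compl_singleton⟩

theorem continuous_coord {n : ℕ} (i : Fin n) : Continuous fun z : PuncturedSpace n => z.1 i :=
  (continuous_apply i).comp continuous_subtype_val

namespace HopfData

variable {n : ℕ} (D : HopfData n)

theorem ne_zero (i : Fin n) : D.μ i ≠ 0 := norm_pos_iff.1 (D.norm_pos i)

/-- The contraction `f` as an automorphism of `W`. -/
def contraction : PuncturedSpace n ≃ₜ PuncturedSpace n where
  toFun z := ⟨fun i => D.μ i * z.1 i, fun h => z.2 (funext fun i =>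
    (mul_eq_zero.1 (congrFun h i)).resolve_left (D.ne_zero i))⟩
  invFun z := ⟨fun i => (D.μ i)⁻¹ * z.1 i, fun h => z.2 (funext fun i =>
    (mul_eq_zero.1 (congrFun h i)).resolve_left (inv_ne_zero (D.ne_zero i)))⟩
  left_inv _ := Subtype.ext (funext fun i => inv_mul_cancel_left₀ (D.ne_zero i) _)
  right_inv _ := Subtype.ext (funext fun i => mul_inv_cancel_left₀ (D.ne_zero i) _)
  continuous_toFun := Continuous.subtype_mk (continuous_pi fun i =>
    continuous_const.mul (continuous_coord i)) _
  continuous_invFun := Continuous.subtype_mk (continuous_pi fun i =>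
    continuous_const.mul (continuous_coord i)) _

theorem contraction_zpow_apply (k : ℤ) (z : PuncturedSpace n) (i : Fin n) :
    ((D.contraction ^ k) z).1 i = D.μ i ^ k * z.1 i := by
  induction k with
  | zero => simp
  | succ k ih =>
    rw [add_comm, zpow_add, Homeomorph.mul_apply, zpow_add₀ (D.ne_zero i), zpow_one, zpow_one,
      mul_assoc, ← ih]
    rfl
  | pred k ih =>
    rw [sub_eq_neg_add, zpow_add, Homeomorph.mul_apply, zpow_add₀ (D.ne_zero i), zpow_neg_one,
      zpow_neg_one, mul_assoc, ← ih]
    rfl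

instance : IsCoveringAction D.contraction where
  exists_nhds p := by
    obtain ⟨i, hi⟩ : ∃ i, p.1 i ≠ 0 := by
      by_contra! h
      exact p.2 (funext h)
    have hp : 0 < ‖p.1 i‖ := norm_pos_iff.2 hi
    have h0 := D.norm_pos i
    have h1 := D.norm_lt_one i
    set m := ‖D.μ i‖
    set s := √m
    have hs0 : 0 < s := Real.sqrt_pos.2 h0
    have hs1 : s < 1 := by simpa using Real.sqrt_lt_sqrt h0.le h1
    have hss : s * s = m := Real.mul_self_sqrt h0.le
    have hc : Continuous fun z : PuncturedSpace n => ‖z.1 i‖ := (continuous_coord i).norm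
    refine ⟨{z | s * ‖p.1 i‖ < ‖z.1 i‖ ∧ s * ‖z.1 i‖ < ‖p.1 i‖},
      (isOpen_lt continuous_const hc).inter (isOpen_lt (hc.const_mul s) continuous_const),
      ⟨by nlinarith, by nlinarith⟩, ?_⟩
    rintro k x ⟨hx1, hx2⟩ ⟨hy1, hy2⟩
    rw [D.contraction_zpow_apply, norm_mul, norm_zpow] at hy1 hy2
    change s * _ < m ^ k * _ at hy1
    change s * (m ^ k * _) < _ at hy2
    have hx0 : 0 < ‖x.1 i‖ := lt_trans (by positivity) hx1
    by_contra hk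
    rcases lt_or_gt_of_ne hk with hk | hk
    · have h2 : 1 ≤ m * m ^ k := by
        rw [← zpow_one_add₀ h0.ne']
        exact one_le_zpow_of_nonpos₀ h0 h1.le (by omega)
      nlinarith [mul_lt_mul_of_pos_left hy2 hs0, mul_le_mul_of_nonneg_right h2 hx0.le]
    · have h2 : m ^ k ≤ m := by
        have := zpow_le_zpow_right_of_le_one₀ h0 h1.le (show (1 : ℤ) ≤ k by omega)
        simpa using this
      nlinarith [mul_lt_mul_of_pos_left hx2 hs0, mul_le_mul_of_nonneg_right h2 hx0.le]

instance : IsBiholomorphic 𝓘(ℂ, Fin n → ℂ) D.contraction where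
  contMDiff := by
    refine fun x => (ChartedSpace.liftPropWithinAt_subtypeVal_comp_iff _ _ _).1 ?_
    exact (contMDiff_iff_contDiff.2 (by fun_prop :
      ContDiff ℂ ω fun z : Fin n → ℂ => fun i => D.μ i * z i)).comp contMDiff_subtype_val x
  contMDiff_symm := by
    refine fun x => (ChartedSpace.liftPropWithinAt_subtypeVal_comp_iff _ _ _).1 ?_
    exact (contMDiff_iff_contDiff.2 (by fun_prop :
      ContDiff ℂ ω fun z : Fin n → ℂ => fun i => (D.μ i)⁻¹ * z i)).comp contMDiff_subtype_val x

/-- The Hopf manifold `X = W / ⟨f⟩`, a complex manifold of dimension `n`. -/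
abbrev HopfManifold : Type := CyclicQuotient D.contraction

/-- The projection `π : W → X`. -/
def proj (z : PuncturedSpace n) : D.HopfManifold := CyclicQuotient.mk D.contraction z

/-- The automorphism `(z, v) ↦ (f z, b v)` of `W × ℂ`. -/
def lift (b : ℂˣ) : (PuncturedSpace n × ℂ) ≃ₜ (PuncturedSpace n × ℂ) :=
  D.contraction.prodCongr (Homeomorph.mulLeft₀ (b : ℂ) b.ne_zero)

theorem lift_zpow_fst (b : ℂˣ) (k : ℤ) (p : PuncturedSpace n × ℂ) :
    ((D.lift b ^ k) p).1 = (D.contraction ^ k) p.1 := by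
  induction k with
  | zero => simp
  | succ k ih =>
    rw [add_comm, zpow_add, zpow_add, Homeomorph.mul_apply, Homeomorph.mul_apply, ← ih]
    rfl
  | pred k ih =>
    rw [sub_eq_neg_add, zpow_add, zpow_add, Homeomorph.mul_apply, Homeomorph.mul_apply, ← ih]
    rfl

instance (b : ℂˣ) : IsCoveringAction (D.lift b) where
  exists_nhds p := by
    obtain ⟨U, hU, hp, h⟩ := IsCoveringAction.exists_nhds (f := D.contraction) p.1
    refine ⟨Prod.fst ⁻¹' U, hU.preimage continuous_fst, hp, fun k x hx hkx => h k x.1 hx ?_⟩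
    rw [← D.lift_zpow_fst b]
    exact hkx

instance (b : ℂˣ) : IsBiholomorphic (𝓘(ℂ, Fin n → ℂ).prod 𝓘(ℂ, ℂ)) (D.lift b) where
  contMDiff := ContMDiff.prodMap (IsBiholomorphic.contMDiff (f := D.contraction))
    (contMDiff_iff_contDiff.2 (by fun_prop : ContDiff ℂ ω fun v : ℂ => (b : ℂ) * v))
  contMDiff_symm := ContMDiff.prodMap (IsBiholomorphic.contMDiff_symm (f := D.contraction))
    (contMDiff_iff_contDiff.2 (by fun_prop : ContDiff ℂ ω fun v : ℂ => (b : ℂ)⁻¹ * v))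

/-- The total space of the holomorphic line bundle `L_b` on `X`: the quotient of `W × ℂ` by
`(z, v) ↦ (f z, b v)`, a complex manifold of dimension `n + 1`. -/
abbrev LineBundle (b : ℂˣ) : Type := CyclicQuotient (D.lift b)

/-- The class `[z, v]` in `L_b` of a point `(z, v)` of `W × ℂ`. -/
def lineMk (b : ℂˣ) (z : PuncturedSpace n) (v : ℂ) : D.LineBundle b :=
  CyclicQuotient.mk (D.lift b) (z, v)

/-- The bundle projection `L_b → X`, `[z, v] ↦ π z`. -/
def lineProj (b : ℂˣ) : D.LineBundle b → D.HopfManifold :=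
  Quotient.lift (fun p => D.proj p.1) (by
    rintro p _ ⟨k, rfl⟩
    exact (CyclicQuotient.mk_eq_mk_iff _).2 ⟨k, (D.lift_zpow_fst b k p).symm⟩)

/-- `X` is generic: the multipliers are ordered by modulus and satisfy no nontrivial relation
`∏_{i ∈ A} μ_i ^ r_i = ∏_{j ∈ B} μ_j ^ r_j` with `A ⊔ B = {1, …, n}`. -/
structure IsGeneric : Prop where
  monotone : Monotone fun i => ‖D.μ i‖
  no_relation : ∀ (A B : Finset (Fin n)) (r : Fin n → ℕ), Disjoint A B → A ∪ B = Finset.univ →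
    ∏ i ∈ A, D.μ i ^ r i = ∏ j ∈ B, D.μ j ^ r j → r = 0

/-- A one-dimensional holomorphic foliation on `X`, possibly singular: a line bundle
`T_𝓕 = L_b` on `X` with a holomorphic morphism of vector bundles `T_𝓕 → TX` which does not vanish
identically. -/
structure Foliation where
  /-- the multiplier of the tangent bundle `L_b` of the foliation -/
  b : ℂˣ
  /-- the morphism, as a map over the identity of `X` -/
  toFun : ∀ ℓ : D.LineBundle b, TangentSpace 𝓘(ℂ, Fin n → ℂ) (D.lineProj b ℓ)
  /-- linearity on the fibre `{[z, v] : v ∈ ℂ}` over `π z` -/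
  linear : ∀ z : PuncturedSpace n,
    IsLinearMap ℂ (M₂ := TangentSpace 𝓘(ℂ, Fin n → ℂ) (D.proj z))
      (fun v : ℂ => toFun (D.lineMk b z v))
  /-- holomorphy, as a map between the total spaces -/
  holomorphic : ContMDiff (𝓘(ℂ, Fin n → ℂ).prod 𝓘(ℂ, ℂ)) 𝓘(ℂ, Fin n → ℂ).tangent ω
    (fun ℓ => (⟨D.lineProj b ℓ, toFun ℓ⟩ : TangentBundle 𝓘(ℂ, Fin n → ℂ) D.HopfManifold))
  nontrivial : ∃ ℓ, toFun ℓ ≠ 0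

/-- The foliation `𝓕` is induced by the vector field `V = ∑ V_k ∂/∂z_k` on `W`: under the
tautological trivialization `(z, v) ↦ [z, v]` of `π^* L_b` and the isomorphism `dπ : TW → π^* TX`,
the pull-back to `W` of the morphism `L_b → TX` is `(z, v) ↦ v • V z`. -/
def Foliation.IsInducedBy {D : HopfData n} (F : D.Foliation)
    (V : (Fin n → ℂ) → (Fin n → ℂ)) : Prop :=
  ∀ (z : PuncturedSpace n) (v : ℂ),
    (F.toFun (D.lineMk F.b z v) : TangentSpace 𝓘(ℂ, Fin n → ℂ) (D.proj z)) =
      v • mfderiv 𝓘(ℂ, Fin n → ℂ) 𝓘(ℂ, Fin n → ℂ) D.proj z (V z.1)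

end HopfData

/-- `V` is a monomial vector field: there are `d ∈ ℤⁿ` and `c ∈ ℂⁿ \ {0}` such that the `k`-th
component of `V` is `c_k z^d z_k`, all exponents being nonnegative in the components with
`c_k ≠ 0`. -/
def IsMonomialVectorField {n : ℕ} (V : (Fin n → ℂ) → (Fin n → ℂ)) : Prop :=
  ∃ (d : Fin n → ℤ) (c : Fin n → ℂ), c ≠ 0 ∧
    (∀ k, c k ≠ 0 → ∀ j, 0 ≤ d j + if j = k then 1 else 0) ∧
    ∀ z k, V z k = c k * ∏ j, z j ^ (d j + if j = k then 1 else 0)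

end HopfFoliation

namespace HopfFoliation

/-! ### Entire functions of one variable with controlled growth on a sequence of circles -/

/-! Pulled back to `W`, the morphism `L_b → TX` is a holomorphic vector field `V` with `b V(f z) =
diag(μ) V(z)`, so each component satisfies `V_k ∘ f = (μ_k / b) V_k`. The theorem thus rests on
holomorphic functions `g` on `W` with `g ∘ f = c g`, `c ≠ 0`.

Such a `g` is a polynomial (`HopfData.exists_mvPolynomial`), and no Hartogs extension is needed. On
a line in the direction `z_i` that misses the origin, `g` is entire. For large `k`, `f^k` carries
the circle `|z_i| = |μ_i|^(-k)` of this line into a fixed compact subset of `W`, so `|g| ≤ C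
|c|^(-k)` there. Cauchy's estimates leave a polynomial of degree `< N`, with `N` independent of the
line. Lagrange interpolation, one variable at a time, assembles these into a polynomial in all
variables.

Comparing coefficients in `g ∘ f = c g` gives `μ^α = c` for every monomial `z^α` of `g`. Hence `μ^(α
- e_k) = b⁻¹` for every monomial of every `V_k`, and genericity makes `d = α - e_k` independent of
both `α` and `k`: the field is monomial.

The remaining work is differential geometry: `π` is locally biholomorphic, so `V` exists, is
holomorphic and is equivariant. -/

/-- Cauchy estimates on circles of radii `r ^ (-k)`. -/
theorem iteratedDeriv_zero_of_sphere_bound {h : ℂ → ℂ} (hh : Differentiable ℂ h) {r l C : ℝ}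
    (hr : 0 < r) (hl : 0 < l) {m : ℕ} (hm : r ^ m < l)
    (hb : ∀ᶠ k : ℕ in Filter.atTop, ∀ w : ℂ, ‖w‖ = (r ^ k)⁻¹ → ‖h w‖ ≤ C * (l ^ k)⁻¹) :
    iteratedDeriv m h 0 = 0 := by
  -- Cauchy on radius `r^(-k)` divides `C l^(-k)` by `r^(-km)`, leaving a geometric sequence of
  -- ratio `r^m / l < 1`.
  have key : ∀ᶠ k : ℕ in Filter.atTop,
      ‖iteratedDeriv m h 0‖ ≤ m.factorial * C * (r ^ m / l) ^ k := by
    filter_upwards [hb] with k hk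
    have h1 := Complex.norm_iteratedDeriv_le_of_forall_mem_sphere_norm_le (c := 0) m
      (inv_pos.2 (pow_pos hr k)) hh.diffContOnCl (fun w hw => hk w (by simpa using hw))
    refine h1.trans (le_of_eq ?_)
    rw [div_pow, ← pow_mul, inv_pow, ← pow_mul, mul_comm k m]
    field_simp
  have h0 : Filter.Tendsto (fun k : ℕ => m.factorial * C * (r ^ m / l) ^ k) Filter.atTop (𝓝 0) := by
    simpa using (tendsto_pow_atTop_nhds_zero_of_lt_one (by positivity)
      ((div_lt_one hl).2 hm)).const_mul (m.factorial * C)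
  exact norm_le_zero_iff.1 (ge_of_tendsto h0 key)

theorem exists_polynomial_of_sphere_bound {h : ℂ → ℂ} (hh : Differentiable ℂ h) {r l C : ℝ}
    (hr : 0 < r) (hr1 : r < 1) (hl : 0 < l) {N : ℕ} (hN : r ^ N < l)
    (hb : ∀ᶠ k : ℕ in Filter.atTop, ∀ w : ℂ, ‖w‖ = (r ^ k)⁻¹ → ‖h w‖ ≤ C * (l ^ k)⁻¹) :
    ∃ p : Polynomial ℂ, p.degree < N ∧ ∀ w, h w = p.eval w := by
  refine ⟨∑ m ∈ Finset.range N,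
    Polynomial.C ((m.factorial : ℂ)⁻¹ * iteratedDeriv m h 0) * Polynomial.X ^ m, ?_, fun w => ?_⟩
  · rw [Polynomial.degree_lt_iff_coeff_zero]
    intro k hk
    rw [Polynomial.finsetSum_coeff]
    refine Finset.sum_eq_zero fun m hm => ?_
    rw [Polynomial.coeff_C_mul_X_pow, if_neg]
    have := Finset.mem_range.1 hm
    omega
  · rw [← Complex.taylorSeries_eq_of_entire' 0 w hh, tsum_eq_sum (s := Finset.range N)]
    · simp [Polynomial.eval_finsetSum]
    · intro m hm
      have hm' : N ≤ m := by simpa using hm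
      rw [iteratedDeriv_zero_of_sphere_bound hh hr hl
        ((pow_le_pow_of_le_one hr.le hr1.le hm').trans_lt hN) hb]
      simp

/-! ### Functions which are polynomial along the coordinate lines -/

section Interpolation

variable {n : ℕ} {g : (Fin n → ℂ) → ℂ} {N : ℕ}

/-- The polynomial function `z ↦ L_j(z_i)`, where `L_j` is the Lagrange basis with nodes
`1, …, N`. -/
def lagrangeVar (n N : ℕ) (i : Fin n) (j : ℕ) : MvPolynomial (Fin n) ℂ :=
  Polynomial.aeval (MvPolynomial.X i)
    (Lagrange.basis (Finset.range N) (fun j : ℕ => (j : ℂ) + 1) j)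

theorem eval_lagrangeVar (i : Fin n) (j : ℕ) (z : Fin n → ℂ) :
    MvPolynomial.eval z (lagrangeVar n N i j) =
      (Lagrange.basis (Finset.range N) (fun j : ℕ => (j : ℂ) + 1) j).eval (z i) := by
  rw [lagrangeVar, ← Polynomial.eval_map_algebraMap, ← Polynomial.eval₂_eq_eval_map,
    Polynomial.hom_eval₂]
  simp only [MvPolynomial.eval_X]
  congr 1
  ext c
  simp

/-- `g` is polynomial of degree `< N` on the lines parallel to the coordinate axes and avoiding
the origin. -/
def IsLinePolynomial (g : (Fin n → ℂ) → ℂ) (N : ℕ) : Prop :=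
  ∀ (z : Fin n → ℂ) (i : Fin n), (∃ j ≠ i, z j ≠ 0) →
    ∃ p : Polynomial ℂ, p.degree < N ∧ ∀ w, g (Function.update z i w) = p.eval w

theorem IsLinePolynomial.eq_interpolate (hg : IsLinePolynomial g N) {z : Fin n → ℂ} {i : Fin n}
    (hz : ∃ j ≠ i, z j ≠ 0) :
    g z = ∑ j ∈ Finset.range N, g (Function.update z i ((j : ℂ) + 1)) *
      MvPolynomial.eval z (lagrangeVar n N i j) := by
  obtain ⟨p, hp, hgp⟩ := hg z i hz
  have hinj : Set.InjOn (fun j : ℕ => (j : ℂ) + 1) (Finset.range N) := by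
    intro a _ b _ hab
    simpa using hab
  have h1 := Lagrange.eq_interpolate (s := Finset.range N) hinj (by simpa using hp)
  have h2 := hgp (z i)
  rw [Function.update_eq_self, h1, Lagrange.interpolate_apply, Polynomial.eval_finsetSum] at h2
  rw [h2]
  refine Finset.sum_congr rfl fun j _ => ?_
  rw [eval_lagrangeVar, hgp, Polynomial.eval_mul, Polynomial.eval_C]

/-- Induction on the set `S` of free coordinates: interpolating in a new variable `z_i` reduces to
the frozen values `z_i = 1, …, N`. A nonzero frozen coordinate outside `S` keeps every line used
away from the origin. -/
theorem IsLinePolynomial.exists_mvPolynomial_piecewise (hg : IsLinePolynomial g N)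
    (S : Finset (Fin n)) : ∀ z : Fin n → ℂ, (∃ j ∉ S, z j ≠ 0) →
    ∃ P : MvPolynomial (Fin n) ℂ, ∀ u, g (S.piecewise u z) = MvPolynomial.eval u P := by
  induction S using Finset.induction_on with
  | empty => exact fun z _ => ⟨MvPolynomial.C (g z), fun u => by simp⟩
  | insert i S hi ih =>
    rintro z ⟨j, hj, hzj⟩
    rw [Finset.mem_insert, not_or] at hj
    have h1 : ∀ a : ℕ, ∃ P : MvPolynomial (Fin n) ℂ, ∀ u,
        g (S.piecewise u (Function.update z i ((a : ℂ) + 1))) = MvPolynomial.eval u P :=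
      fun a => ih _ ⟨j, hj.2, by rwa [Function.update_of_ne hj.1]⟩
    choose P hP using h1
    refine ⟨∑ a ∈ Finset.range N, P a * lagrangeVar n N i a, fun u => ?_⟩
    rw [hg.eq_interpolate (i := i) ⟨j, hj.1, by simpa [Finset.piecewise, hj] using hzj⟩, map_sum]
    refine Finset.sum_congr rfl fun a _ => ?_
    rw [map_mul, ← hP, eval_lagrangeVar, eval_lagrangeVar]
    congr 2
    · ext k
      by_cases hk : k = i
      · subst hk
        simp [Finset.piecewise, hi]
      · simp [Finset.piecewise, hk]
    · simp

theorem IsLinePolynomial.exists_mvPolynomial_of_ne (hg : IsLinePolynomial g N) (i : Fin n) :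
    ∃ P : MvPolynomial (Fin n) ℂ, ∀ z : Fin n → ℂ, (∃ j ≠ i, z j ≠ 0) →
      g z = MvPolynomial.eval z P := by
  -- The nodes `a + 1` are nonzero, so after freezing `z_i` at a node all other coordinates may vary
  -- freely, even vanish together.
  have h1 : ∀ a : ℕ, ∃ P : MvPolynomial (Fin n) ℂ, ∀ u,
      g ((Finset.univ.erase i).piecewise u (Function.update 0 i ((a : ℂ) + 1))) =
        MvPolynomial.eval u P :=
    fun a => hg.exists_mvPolynomial_piecewise _ _
      ⟨i, by simp, by simpa using Nat.cast_add_one_ne_zero a⟩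
  choose P hP using h1
  refine ⟨∑ a ∈ Finset.range N, P a * lagrangeVar n N i a, fun z hz => ?_⟩
  rw [hg.eq_interpolate hz, map_sum]
  refine Finset.sum_congr rfl fun a _ => ?_
  rw [map_mul, ← hP]
  congr 2
  ext k
  by_cases hk : k = i
  · subst hk
    simp [Finset.piecewise]
  · simp [Finset.piecewise, hk]

theorem mvPolynomial_eq_of_forall_ne_zero {P Q : MvPolynomial (Fin n) ℂ}
    (h : ∀ z : Fin n → ℂ, (∀ i, z i ≠ 0) → MvPolynomial.eval z P = MvPolynomial.eval z Q) :
    P = Q :=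
  MvPolynomial.funext_set (fun _ => {0}ᶜ) (fun _ => (Set.finite_singleton 0).infinite_compl)
    fun z hz => h z fun i => hz i (mem_univ i)

/-- Interpolation in `z_i` fails only on the `i`-axis. Two different axes meet only at the origin,
and the two resulting polynomials agree where no coordinate vanishes, hence are equal. -/
theorem IsLinePolynomial.exists_mvPolynomial (hn : 2 ≤ n) (hg : IsLinePolynomial g N) :
    ∃ P : MvPolynomial (Fin n) ℂ, ∀ z ≠ 0, g z = MvPolynomial.eval z P := by
  have : Nontrivial (Fin n) := Fin.nontrivial_iff_two_le.2 hn
  obtain ⟨i, i', hi⟩ := exists_pair_ne (Fin n)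
  obtain ⟨P, hP⟩ := hg.exists_mvPolynomial_of_ne i
  obtain ⟨Q, hQ⟩ := hg.exists_mvPolynomial_of_ne i'
  have hPQ : P = Q := mvPolynomial_eq_of_forall_ne_zero fun z hz => by
    rw [← hP z ⟨i', hi.symm, hz _⟩, ← hQ z ⟨i, hi, hz _⟩]
  refine ⟨P, fun z hz => ?_⟩
  obtain ⟨j, hj⟩ : ∃ j, z j ≠ 0 := by
    by_contra! h
    exact hz (funext h)
  by_cases hji : j = i
  · subst hji
    rw [hPQ]
    exact hQ z ⟨j, hi, hj⟩
  · exact hP z ⟨j, hji, hj⟩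

end Interpolation

/-! ### Holomorphic functions on `W` which are homogeneous under the contraction -/

namespace HopfData

variable {n : ℕ} (D : HopfData n) {g : (Fin n → ℂ) → ℂ} {c : ℂ}

theorem apply_pow_mul (hc : ∀ z ≠ 0, g (fun i => D.μ i * z i) = c * g z) (k : ℕ) :
    ∀ z ≠ 0, g (fun i => D.μ i ^ k * z i) = c ^ k * g z := by
  induction k with
  | zero => simp
  | succ k ih =>
    intro z hz
    have hz' : (fun i => D.μ i * z i) ≠ 0 := fun h => hz (funext fun i =>
      (mul_eq_zero.1 (congrFun h i)).resolve_left (D.ne_zero i))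
    rw [pow_succ, mul_assoc, ← hc z hz, ← ih _ hz']
    simp only [pow_succ, mul_assoc]

theorem isLinePolynomial (hg : DifferentiableOn ℂ g {0}ᶜ) (hc0 : c ≠ 0)
    (hc : ∀ z ≠ 0, g (fun i => D.μ i * z i) = c * g z) : ∃ N, IsLinePolynomial g N := by
  have hcpos : 0 < ‖c‖ := norm_pos_iff.2 hc0
  have hN : ∀ᶠ N : ℕ in Filter.atTop, ∀ i, ‖D.μ i‖ ^ N < ‖c‖ :=
    Filter.eventually_all.2 fun i => (tendsto_pow_atTop_nhds_zero_of_lt_one (norm_nonneg _)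
      (D.norm_lt_one i)).eventually_lt_const hcpos
  obtain ⟨N, hN⟩ := hN.exists
  refine ⟨N, fun z i hz => ?_⟩
  have hz0 : ∀ w, Function.update z i w ≠ 0 := by
    intro w h
    obtain ⟨j, hj, hzj⟩ := hz
    have := congrFun h j
    rw [Function.update_of_ne hj] at this
    exact hzj this
  have hdiff : Differentiable ℂ fun w => g (Function.update z i w) := fun w =>
    ((hg _ (hz0 w)).differentiableAt (isOpen_compl_singleton.mem_nhds (hz0 w))).comp w
      (hasFDerivAt_update z w).differentiableAt
  -- For large `k`, `f^k` maps the circle `|w| = |μ_i|^(-k)` into `K`: the `i`-th coordinate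
  -- acquires modulus `1` and the fixed ones are contracted below `1`.
  let K : Set (Fin n → ℂ) := Metric.closedBall 0 1 ∩ {u | ‖u i‖ = 1}
  have hK : IsCompact K := (isCompact_closedBall _ _).inter_right
    (isClosed_eq (continuous_apply i).norm continuous_const)
  have hK0 : K ⊆ {0}ᶜ := by
    rintro u ⟨-, hu⟩ rfl
    simp at hu
  obtain ⟨C, hC⟩ := hK.exists_bound_of_continuousOn (hg.continuousOn.mono hK0)
  have hsmall : ∀ᶠ k : ℕ in Filter.atTop, ∀ j, ‖D.μ j‖ ^ k * ‖z j‖ < 1 :=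
    Filter.eventually_all.2 fun j => (by
      simpa using (tendsto_pow_atTop_nhds_zero_of_lt_one (norm_nonneg _)
        (D.norm_lt_one j)).mul_const ‖z j‖ :
      Filter.Tendsto (fun k : ℕ => ‖D.μ j‖ ^ k * ‖z j‖) Filter.atTop (𝓝 0)).eventually_lt_const
        one_pos
  refine exists_polynomial_of_sphere_bound (C := C) hdiff (D.norm_pos i) (D.norm_lt_one i) hcpos
    (hN i) ?_
  filter_upwards [hsmall] with k hk w hw
  have hi : ‖D.μ i‖ ^ k * ‖w‖ = 1 := by
    rw [hw]
    exact mul_inv_cancel₀ (pow_pos (D.norm_pos i) k).ne'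
  have hmem : (fun j => D.μ j ^ k * Function.update z i w j) ∈ K := by
    refine ⟨?_, by simpa using hi⟩
    rw [mem_closedBall_zero_iff, pi_norm_le_iff_of_nonneg zero_le_one]
    intro j
    rw [norm_mul, norm_pow]
    by_cases hj : j = i
    · subst hj
      simpa using hi.le
    · rw [Function.update_of_ne hj]
      exact (hk j).le
  have h1 := hC _ hmem
  rw [D.apply_pow_mul hc k _ (hz0 w), norm_mul, norm_pow] at h1
  rw [← div_eq_mul_inv, le_div_iff₀ (pow_pos hcpos k), mul_comm]
  exact h1

/-- Homogeneous holomorphic functions on `W` are polynomials, all of whose monomials have the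
same multiplier. -/
theorem exists_mvPolynomial (hn : 2 ≤ n) (hg : DifferentiableOn ℂ g {0}ᶜ) (hc0 : c ≠ 0)
    (hc : ∀ z ≠ 0, g (fun i => D.μ i * z i) = c * g z) :
    ∃ P : MvPolynomial (Fin n) ℂ, (∀ z ≠ 0, g z = MvPolynomial.eval z P) ∧
      ∀ α ∈ P.support, ∏ i, D.μ i ^ α i = c := by
  obtain ⟨N, hN⟩ := D.isLinePolynomial hg hc0 hc
  obtain ⟨P, hP⟩ := hN.exists_mvPolynomial hn
  refine ⟨P, hP, fun α hα => ?_⟩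
  -- This polynomial is `P ∘ f - c P`, which vanishes wherever no coordinate does.
  have hQ : ∑ β ∈ P.support,
      MvPolynomial.monomial β ((∏ i, D.μ i ^ β i - c) * P.coeff β) = 0 := by
    refine mvPolynomial_eq_of_forall_ne_zero fun z hz => ?_
    have hz0 : z ≠ 0 := by
      rintro rfl
      exact hz ⟨0, by omega⟩ rfl
    have hz' : (fun i => D.μ i * z i) ≠ 0 := fun h =>
      (mul_ne_zero (D.ne_zero ⟨0, by omega⟩) (hz ⟨0, by omega⟩)) (congrFun h _)
    have h := hc z hz0
    rw [hP _ hz0, hP _ hz', MvPolynomial.eval_eq', MvPolynomial.eval_eq', Finset.mul_sum,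
      ← sub_eq_zero, ← Finset.sum_sub_distrib] at h
    rw [map_zero, map_sum, ← h]
    refine Finset.sum_congr rfl fun β _ => ?_
    rw [MvPolynomial.eval_monomial, Finsupp.prod_fintype _ _ (by simp)]
    simp only [mul_pow, Finset.prod_mul_distrib]
    ring
  have h1 := congrArg (MvPolynomial.coeff α) hQ
  rw [MvPolynomial.coeff_sum, Finset.sum_eq_single α
    (fun β _ hβ => by rw [MvPolynomial.coeff_monomial, if_neg hβ]) (fun h => absurd hα h),
    MvPolynomial.coeff_monomial, if_pos rfl, MvPolynomial.coeff_zero] at h1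
  exact sub_eq_zero.1 ((mul_eq_zero.1 h1).resolve_right (MvPolynomial.mem_support_iff.1 hα))

/-! ### Genericity and the exponents of an equivariant field -/

variable {D}

/-- Genericity: the multipliers are multiplicatively independent. -/
theorem IsGeneric.eq_zero_of_prod_zpow (hD : D.IsGeneric) {m : Fin n → ℤ}
    (hm : ∏ i, D.μ i ^ m i = 1) : m = 0 := by
  classical
  -- Moving the negative exponents to the other side gives a relation of the excluded shape, with
  -- exponents `|m_i|`.
  have h := hD.no_relation (Finset.univ.filter fun i => 0 ≤ m i)
    (Finset.univ.filter fun i => ¬ 0 ≤ m i) (fun i => (m i).natAbs)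
    (Finset.disjoint_filter_filter_not _ _ _) (Finset.filter_union_filter_not_eq _ _) ?_
  · ext i
    simpa using congrFun h i
  · rw [← Finset.prod_filter_mul_prod_filter_not Finset.univ (fun i => 0 ≤ m i)] at hm
    have h1 : ∏ i with 0 ≤ m i, D.μ i ^ (m i).natAbs = ∏ i with 0 ≤ m i, D.μ i ^ m i :=
      Finset.prod_congr rfl fun i hi => by
        rw [← zpow_natCast, Int.natAbs_of_nonneg (Finset.mem_filter.1 hi).2]
    have h2 : ∏ i with ¬ 0 ≤ m i, D.μ i ^ (m i).natAbs =
        (∏ i with ¬ 0 ≤ m i, D.μ i ^ m i)⁻¹ := by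
      rw [← Finset.prod_inv_distrib]
      refine Finset.prod_congr rfl fun i hi => ?_
      have := (Finset.mem_filter.1 hi).2
      rw [← zpow_natCast, Int.ofNat_natAbs_of_nonpos (by omega), zpow_neg]
    rw [h1, h2]
    exact eq_inv_of_mul_eq_one_left hm

/-- An equivariant vector field on `W` is monomial. -/
theorem IsGeneric.isMonomialVectorField (hD : D.IsGeneric) (hn : 2 ≤ n)
    {V : (Fin n → ℂ) → (Fin n → ℂ)} (hV : DifferentiableOn ℂ V {0}ᶜ) {b : ℂ} (hb : b ≠ 0)
    (hVb : ∀ z ≠ 0, ∀ k, b * V (fun i => D.μ i * z i) k = D.μ k * V z k)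
    (hV0 : ∃ z ≠ 0, V z ≠ 0) :
    ∃ V', IsMonomialVectorField V' ∧ ∀ z ≠ 0, V' z = V z := by
  have h1 : ∀ k, ∃ P : MvPolynomial (Fin n) ℂ, (∀ z ≠ 0, V z k = MvPolynomial.eval z P) ∧
      ∀ α ∈ P.support, ∏ i, D.μ i ^ α i = D.μ k / b := by
    intro k
    refine D.exists_mvPolynomial hn (g := fun z => V z k) (differentiableOn_pi.1 hV k)
      (div_ne_zero (D.ne_zero k) hb) fun z hz => ?_
    rw [div_mul_eq_mul_div, ← hVb z hz k, mul_div_cancel_left₀ _ hb]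
  choose P hP hα using h1
  have hexp : ∀ k, ∀ α ∈ (P k).support,
      ∏ i, D.μ i ^ ((α i : ℤ) - if i = k then 1 else 0) = b⁻¹ := by
    intro k α h
    have hk : ∏ i, D.μ i ^ (if i = k then (1 : ℤ) else 0) = D.μ k := by
      rw [Finset.prod_eq_single k (fun i _ hi => by simp [hi]) (by simp)]
      simp
    simp only [zpow_sub₀ (D.ne_zero _), Finset.prod_div_distrib, hk, zpow_natCast, hα k α h]
    have := D.ne_zero k
    field_simp
  obtain ⟨z₀, hz₀, hVz₀⟩ := hV0
  obtain ⟨k₀, hk₀⟩ : ∃ k, V z₀ k ≠ 0 := by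
    by_contra! h
    exact hVz₀ (funext h)
  have hP0 : P k₀ ≠ 0 := fun h => hk₀ (by rw [hP k₀ z₀ hz₀, h, map_zero])
  obtain ⟨α₀, hα₀⟩ := MvPolynomial.support_nonempty.2 hP0
  -- One monomial of one nonzero component determines `d`; independence of the multipliers then
  -- forces it on all others.
  set d : Fin n → ℤ := fun i => (α₀ i : ℤ) - if i = k₀ then 1 else 0 with hd
  have huniq : ∀ k, ∀ α ∈ (P k).support, ∀ i, (α i : ℤ) = d i + if i = k then 1 else 0 := by
    intro k α h i
    have h2 := hD.eq_zero_of_prod_zpow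
      (m := fun i => ((α i : ℤ) - if i = k then 1 else 0) - d i) (by
        simp only [zpow_sub₀ (D.ne_zero _), Finset.prod_div_distrib, hd]
        have e1 := hexp k α h
        have e2 := hexp k₀ α₀ hα₀
        simp only [zpow_sub₀ (D.ne_zero _), Finset.prod_div_distrib] at e1 e2
        rw [e1, e2]
        exact div_self (inv_ne_zero hb))
    have h3 := congrFun h2 i
    simp only [Pi.zero_apply] at h3
    linarith
  have hmono : ∀ k, ∃ a : ℂ, (a ≠ 0 → ∀ j, 0 ≤ d j + if j = k then 1 else 0) ∧
      (P k ≠ 0 → a ≠ 0) ∧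
      ∀ z, MvPolynomial.eval z (P k) = a * ∏ j, z j ^ (d j + if j = k then 1 else 0) := by
    intro k
    by_cases hk : P k = 0
    · exact ⟨0, by simp, by simp [hk], by simp [hk]⟩
    · obtain ⟨α, hα⟩ := MvPolynomial.support_nonempty.2 hk
      refine ⟨(P k).coeff α, fun _ j => ?_, fun _ => MvPolynomial.mem_support_iff.1 hα,
        fun z => ?_⟩
      · rw [← huniq k α hα j]
        positivity
      · rw [MvPolynomial.eval_eq', Finset.sum_eq_single_of_mem α hα]
        · congr 1
          exact Finset.prod_congr rfl fun j _ => by rw [← huniq k α hα j, zpow_natCast]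
        · intro β hβ hne
          refine absurd (Finsupp.ext fun j => ?_) hne
          have := huniq k α hα j
          have := huniq k β hβ j
          omega
  choose a ha1 ha2 ha3 using hmono
  refine ⟨fun z k => a k * ∏ j, z j ^ (d j + if j = k then 1 else 0),
    ⟨d, a, fun h => ha2 k₀ hP0 (congrFun h k₀), ha1, fun _ _ => rfl⟩, fun z hz => ?_⟩
  funext k
  rw [hP k z hz, ha3]

end HopfData

/-! ### The projection onto a cyclic quotient is locally biholomorphic -/

namespace CyclicQuotient

variable {M : Type*} [TopologicalSpace M] {E H : Type*} [NormedAddCommGroup E] [NormedSpace ℂ E]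
  [TopologicalSpace H] [ChartedSpace H M] (I : ModelWithCorners ℂ E H)
  (f : M ≃ₜ M) [IsCoveringAction f]

/-- Both sides lift the projection. They agree at `z` for a suitable `k`, hence nearby, since the
projection is injective on the target of the local inverse. -/
theorem exists_localInverseAt_mk_eventuallyEq (a z : M)
    (hz : mk f z ∈ ((isLocalHomeomorph_mk f).localInverseAt a).source) :
    ∃ k : ℤ, ∀ᶠ y in 𝓝 z, (isLocalHomeomorph_mk f).localInverseAt a (mk f y) = (f ^ k) y := by
  set hl := isLocalHomeomorph_mk f
  set l := hl.localInverseAt a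
  obtain ⟨k, hk⟩ := (mk_eq_mk_iff f).1 (hl.apply_localInverseAt_of_mem hz).symm
  have ht : ∀ᶠ y in 𝓝 z, (f ^ k) y ∈ l.target :=
    (f ^ k).continuous.continuousAt.preimage_mem_nhds (l.open_target.mem_nhds (by
      rw [hk]; exact l.map_source hz))
  have hs : ∀ᶠ y in 𝓝 z, mk f y ∈ l.source :=
    (continuous_mk f).continuousAt.preimage_mem_nhds (l.open_source.mem_nhds hz)
  refine ⟨k, ?_⟩
  filter_upwards [ht, hs] with y hy hy'
  refine hl.injOn_localInverseAt_target (l.map_source hy') hy ?_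
  rw [hl.apply_localInverseAt_of_mem hy']
  exact (mk_eq_mk_iff f).2 ⟨k, rfl⟩

variable [IsBiholomorphic I f] [IsManifold I ω M]

theorem contMDiff_mk : ContMDiff I I ω (mk f) := by
  intro z
  set hl := isLocalHomeomorph_mk f
  -- The chart at `mk f z` is built from a chosen representative `a` of the orbit, possibly
  -- different from `z`; this is why a power `f^k` enters.
  set a := (mk_surjective f).hasRightInverse.choose (mk f z) with ha
  set l := hl.localInverseAt a with hl'
  have hchart : chartAt H (mk f z) = l.trans (chartAt H a) := rfl
  have hzs := mem_chart_source H (mk f z)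
  have hzs' := hzs
  rw [hchart, OpenPartialHomeomorph.trans_source] at hzs
  obtain ⟨k, hk⟩ := exists_localInverseAt_mk_eventuallyEq f a z hzs.1
  have hfk : ContMDiffAt I I ω (f ^ k : M ≃ₜ M) z := contMDiff_zpow I f k z
  have hkz : l (mk f z) = (f ^ k) z := hk.self_of_nhds
  have hc : ContMDiffAt I I ω (chartAt H a) ((f ^ k : M ≃ₜ M) z) :=
    contMDiffOn_chart.contMDiffAt ((chartAt H a).open_source.mem_nhds (by
      rw [← hkz]; exact hzs.2))
  have h1 : ContMDiffAt I I ω (fun y => chartAt H (mk f z) (mk f y)) z := by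
    refine (hc.comp z hfk).congr_of_eventuallyEq ?_
    filter_upwards [hk] with y hy
    rw [hchart, OpenPartialHomeomorph.coe_trans, Function.comp_apply, hy]
    rfl
  have h2 : ContMDiffAt I I ω (chartAt H (mk f z)).symm (chartAt H (mk f z) (mk f z)) :=
    contMDiffOn_chart_symm.contMDiffAt
      ((chartAt H (mk f z)).open_target.mem_nhds (mem_chart_target H _))
  refine (h2.comp z h1).congr_of_eventuallyEq ?_
  filter_upwards [(continuous_mk f).continuousAt.preimage_mem_nhds
    ((chartAt H (mk f z)).open_source.mem_nhds hzs')] with y hy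
  exact ((chartAt H (mk f z)).left_inv hy).symm

/-- Near `q`, this branch is `f^k` composed with the branch through the representative `a` that
defines the chart at `q`; the latter is read off from that chart. -/
theorem contMDiffOn_localInverseAt (z : M) :
    ContMDiffOn I I ω ((isLocalHomeomorph_mk f).localInverseAt z)
      ((isLocalHomeomorph_mk f).localInverseAt z).source := by
  intro q hq
  refine ContMDiffAt.contMDiffWithinAt ?_
  set hl := isLocalHomeomorph_mk f
  set a := (mk_surjective f).hasRightInverse.choose q with ha
  have hqa : mk f a = q := (mk_surjective f).hasRightInverse.choose_spec q
  set l := hl.localInverseAt a with hl'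
  have hchart : chartAt H q = l.trans (chartAt H a) := rfl
  have hla : l q = a := by rw [← hqa]; exact hl.localInverseAt_apply_self
  obtain ⟨k, hk⟩ := exists_localInverseAt_mk_eventuallyEq f z a (by rwa [hqa])
  have hfk : ContMDiffAt I I ω (f ^ k : M ≃ₜ M) a := contMDiff_zpow I f k a
  have hlq : ContMDiffAt I I ω l q := by
    have h1 : ContMDiffAt I I ω (chartAt H q) q :=
      contMDiffOn_chart.contMDiffAt ((chartAt H q).open_source.mem_nhds (mem_chart_source H q))
    have h2 : ContMDiffAt I I ω (chartAt H a).symm (chartAt H q q) := by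
      refine contMDiffOn_chart_symm.contMDiffAt ((chartAt H a).open_target.mem_nhds ?_)
      rw [hchart, OpenPartialHomeomorph.coe_trans, Function.comp_apply, hla]
      exact mem_chart_target H a
    refine (h2.comp q h1).congr_of_eventuallyEq ?_
    filter_upwards [(chartAt H q).open_source.mem_nhds (mem_chart_source H q)] with y hy
    rw [hchart, OpenPartialHomeomorph.trans_source] at hy
    rw [Function.comp_apply, hchart, OpenPartialHomeomorph.coe_trans, Function.comp_apply,
      (chartAt H a).left_inv hy.2]
  have hfk' : ContMDiffAt I I ω (f ^ k : M ≃ₜ M) (l q) := by rwa [hla]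
  refine (hfk'.comp q hlq).congr_of_eventuallyEq ?_
  have hqs : q ∈ l.source := by
    rw [← hqa]; exact hl.apply_self_mem_localInverseAt_source
  have hk' : ∀ᶠ y in 𝓝 q, hl.localInverseAt z (mk f (l y)) = (f ^ k) (l y) := by
    have := hlq.continuousAt
    rw [ContinuousAt, hla] at this
    exact this.eventually hk
  filter_upwards [hk', l.open_source.mem_nhds hqs] with y hy hys
  rw [Function.comp_apply, ← hy, hl.apply_localInverseAt_of_mem hys]

end CyclicQuotient

/-! ### The vector field on `W` inducing a foliation -/

namespace HopfData

variable {n : ℕ} (D : HopfData n)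

/-- The inclusion is the extended chart at `z`, the very chart that identifies the tangent space at
`z` with `ℂⁿ`. -/
theorem mfderiv_val (z : PuncturedSpace n) :
    (mfderiv 𝓘(ℂ, Fin n → ℂ) 𝓘(ℂ, Fin n → ℂ) (Subtype.val : PuncturedSpace n → Fin n → ℂ) z :
      (Fin n → ℂ) →L[ℂ] (Fin n → ℂ)) = ContinuousLinearMap.id ℂ (Fin n → ℂ) :=
  mfderiv_extChartAt_self (I := 𝓘(ℂ, Fin n → ℂ)) (x := z)

theorem contMDiff_proj :
    ContMDiff 𝓘(ℂ, Fin n → ℂ) 𝓘(ℂ, Fin n → ℂ) ω D.proj :=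
  CyclicQuotient.contMDiff_mk _ _

theorem contMDiff_lineMk (b : ℂˣ) (v : ℂ) :
    ContMDiff 𝓘(ℂ, Fin n → ℂ) (𝓘(ℂ, Fin n → ℂ).prod 𝓘(ℂ, ℂ)) ω (fun z => D.lineMk b z v) :=
  (CyclicQuotient.contMDiff_mk (𝓘(ℂ, Fin n → ℂ).prod 𝓘(ℂ, ℂ)) (D.lift b)).comp
    (contMDiff_id.prodMk contMDiff_const)

/-- The branch through `a` of the inverse of the projection `π`, with values in `ℂⁿ`. -/
def branch (a : PuncturedSpace n) (q : D.HopfManifold) : Fin n → ℂ :=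
  ((CyclicQuotient.isLocalHomeomorph_mk D.contraction).localInverseAt a q).1

/-- The open set in `X` on which `branch a` inverts the projection. -/
def branchDomain (a : PuncturedSpace n) : Set D.HopfManifold :=
  ((CyclicQuotient.isLocalHomeomorph_mk D.contraction).localInverseAt a).source

theorem isOpen_branchDomain (a : PuncturedSpace n) : IsOpen (D.branchDomain a) :=
  ((CyclicQuotient.isLocalHomeomorph_mk D.contraction).localInverseAt a).open_source

theorem contMDiffOn_branch (a : PuncturedSpace n) :
    ContMDiffOn 𝓘(ℂ, Fin n → ℂ) 𝓘(ℂ, Fin n → ℂ) ω (D.branch a) (D.branchDomain a) :=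
  contMDiff_subtype_val.comp_contMDiffOn
    (CyclicQuotient.contMDiffOn_localInverseAt 𝓘(ℂ, Fin n → ℂ) D.contraction a)

theorem eventually_branch_proj (a : PuncturedSpace n) :
    ∀ᶠ z in 𝓝 a, D.proj z ∈ D.branchDomain a ∧ D.branch a (D.proj z) = z.1 := by
  set hl := CyclicQuotient.isLocalHomeomorph_mk D.contraction
  filter_upwards [(hl.localInverseAt a).open_target.mem_nhds hl.self_mem_localInverseAt_target]
    with z hz
  have h1 := (hl.localInverseAt a).map_target hz
  have h2 := (hl.localInverseAt a).right_inv hz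
  rw [hl.localInverseAt_symm] at h1 h2
  exact ⟨h1, congrArg Subtype.val h2⟩

/-- The differential of the projection, as an endomorphism of `ℂⁿ`. -/
def dproj (z : PuncturedSpace n) : (Fin n → ℂ) →L[ℂ] (Fin n → ℂ) :=
  mfderiv 𝓘(ℂ, Fin n → ℂ) 𝓘(ℂ, Fin n → ℂ) D.proj z

/-- The differential of a branch of the inverse of the projection, as an endomorphism of `ℂⁿ`. -/
def dbranch (a : PuncturedSpace n) (q : D.HopfManifold) : (Fin n → ℂ) →L[ℂ] (Fin n → ℂ) :=
  mfderiv 𝓘(ℂ, Fin n → ℂ) 𝓘(ℂ, Fin n → ℂ) (D.branch a) q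

theorem eventually_dbranch_comp_dproj (a : PuncturedSpace n) :
    ∀ᶠ z in 𝓝 a, (D.dbranch a (D.proj z)).comp (D.dproj z) = ContinuousLinearMap.id ℂ _ := by
  filter_upwards [(D.eventually_branch_proj a).eventually_nhds] with z hz
  have hb : MDifferentiableAt 𝓘(ℂ, Fin n → ℂ) 𝓘(ℂ, Fin n → ℂ) (D.branch a) (D.proj z) :=
    ((D.contMDiffOn_branch a).contMDiffAt
      ((D.isOpen_branchDomain a).mem_nhds hz.self_of_nhds.1)).mdifferentiableAt (by simp)
  have hp : MDifferentiableAt 𝓘(ℂ, Fin n → ℂ) 𝓘(ℂ, Fin n → ℂ) D.proj z :=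
    D.contMDiff_proj.mdifferentiableAt (by simp)
  have h1 := mfderiv_comp z hb hp
  have h2 : D.branch a ∘ D.proj =ᶠ[𝓝 z] Subtype.val := hz.mono fun y hy => hy.2
  rw [h2.mfderiv_eq] at h1
  exact h1.symm.trans (mfderiv_val z)

/-- In finite dimension a one-sided inverse is two-sided. -/
theorem eventually_dproj_comp_dbranch (a : PuncturedSpace n) :
    ∀ᶠ z in 𝓝 a, (D.dproj z).comp (D.dbranch a (D.proj z)) = ContinuousLinearMap.id ℂ _ := by
  filter_upwards [D.eventually_dbranch_comp_dproj a] with z hz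
  have h1 : (D.dbranch a (D.proj z)).toLinearMap ∘ₗ (D.dproj z).toLinearMap = LinearMap.id :=
    congrArg ContinuousLinearMap.toLinearMap hz
  have h2 := (LinearMap.comp_eq_id_comm ℂ (Fin n → ℂ)).1 h1
  ext v i
  exact congrFun (LinearMap.congr_fun h2 _) i

theorem dproj_injective (z : PuncturedSpace n) : Function.Injective (D.dproj z) :=
  Function.LeftInverse.injective (g := D.dbranch z (D.proj z)) fun v =>
    DFunLike.congr_fun (D.eventually_dbranch_comp_dproj z).self_of_nhds v

theorem proj_contraction (z : PuncturedSpace n) : D.proj (D.contraction z) = D.proj z :=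
  ((CyclicQuotient.mk_eq_mk_iff _).2 ⟨1, by simp⟩ : D.proj z = D.proj (D.contraction z)).symm

theorem lineMk_contraction (b : ℂˣ) (z : PuncturedSpace n) (v : ℂ) :
    D.lineMk b (D.contraction z) (b * v) = D.lineMk b z v :=
  ((CyclicQuotient.mk_eq_mk_iff _).2 ⟨1, by rw [zpow_one]; rfl⟩ :
    D.lineMk b z v = D.lineMk b (D.contraction z) (b * v)).symm

/-- The contraction as an endomorphism of `ℂⁿ`. -/
def diag : (Fin n → ℂ) →L[ℂ] (Fin n → ℂ) :=
  ContinuousLinearMap.pi fun i => D.μ i • ContinuousLinearMap.proj i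

theorem mfderiv_contraction (z : PuncturedSpace n) :
    (mfderiv 𝓘(ℂ, Fin n → ℂ) 𝓘(ℂ, Fin n → ℂ) D.contraction z :
      (Fin n → ℂ) →L[ℂ] (Fin n → ℂ)) = D.diag := by
  have hv : ∀ y : PuncturedSpace n, MDifferentiableAt 𝓘(ℂ, Fin n → ℂ) 𝓘(ℂ, Fin n → ℂ)
      (Subtype.val : PuncturedSpace n → Fin n → ℂ) y := fun y =>
    (contMDiff_subtype_val (n := ω)).mdifferentiableAt (by simp)
  have hf : MDifferentiableAt 𝓘(ℂ, Fin n → ℂ) 𝓘(ℂ, Fin n → ℂ) D.contraction z :=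
    (IsBiholomorphic.contMDiff (I := 𝓘(ℂ, Fin n → ℂ)) (f := D.contraction)).mdifferentiableAt
      (by simp)
  have h1 := mfderiv_comp z (hv _) hf
  have h2 := mfderiv_comp z (D.diag.mdifferentiableAt (x := z.1)) (hv z)
  have h3 : (Subtype.val : PuncturedSpace n → Fin n → ℂ) ∘ D.contraction =
      D.diag ∘ Subtype.val := rfl
  rw [h3, h2] at h1
  rw [ContinuousLinearMap.mfderiv_eq] at h1
  have h4 : D.diag.comp (ContinuousLinearMap.id ℂ _) = (ContinuousLinearMap.id ℂ _).comp
      (mfderiv 𝓘(ℂ, Fin n → ℂ) 𝓘(ℂ, Fin n → ℂ) D.contraction z :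
      (Fin n → ℂ) →L[ℂ] (Fin n → ℂ)) := by
    have e1 := congrArg (fun A : (Fin n → ℂ) →L[ℂ] (Fin n → ℂ) => D.diag.comp A) (mfderiv_val z)
    have e2 := congrArg (fun A : (Fin n → ℂ) →L[ℂ] (Fin n → ℂ) => A.comp
      (mfderiv 𝓘(ℂ, Fin n → ℂ) 𝓘(ℂ, Fin n → ℂ) D.contraction z :
      (Fin n → ℂ) →L[ℂ] (Fin n → ℂ))) (mfderiv_val (D.contraction z))
    exact e1.symm.trans (h1.trans e2)
  exact h4.symm

theorem dproj_contraction (z : PuncturedSpace n) :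
    (D.dproj (D.contraction z)).comp D.diag = D.dproj z := by
  have hp : ∀ y, MDifferentiableAt 𝓘(ℂ, Fin n → ℂ) 𝓘(ℂ, Fin n → ℂ) D.proj y := fun y =>
    D.contMDiff_proj.mdifferentiableAt (by simp)
  have hf : MDifferentiableAt 𝓘(ℂ, Fin n → ℂ) 𝓘(ℂ, Fin n → ℂ) D.contraction z :=
    (IsBiholomorphic.contMDiff (I := 𝓘(ℂ, Fin n → ℂ)) (f := D.contraction)).mdifferentiableAt
      (by simp)
  have h1 := mfderiv_comp z (hp _) hf
  rw [← mfderiv_contraction]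
  refine Eq.trans h1.symm ?_
  have h2 : D.proj ∘ D.contraction = D.proj := funext D.proj_contraction
  unfold dproj
  congr 1

namespace Foliation

variable {D} (F : D.Foliation)

/-- The value of the morphism `L_b → TX`, as a vector of `ℂⁿ`. -/
def val (ℓ : D.LineBundle F.b) : Fin n → ℂ := F.toFun ℓ

/-- The vector field on `W` which induces the foliation. -/
def vectorField (z : PuncturedSpace n) : Fin n → ℂ :=
  D.dbranch z (D.proj z) (F.val (D.lineMk F.b z 1))

theorem val_smul (z : PuncturedSpace n) (v : ℂ) :
    F.val (D.lineMk F.b z v) = v • F.val (D.lineMk F.b z 1) := by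
  have h := (F.linear z).map_smul v 1
  rw [smul_eq_mul, mul_one] at h
  exact h

theorem dproj_vectorField (z : PuncturedSpace n) :
    D.dproj z (F.vectorField z) = F.val (D.lineMk F.b z 1) :=
  DFunLike.congr_fun (D.eventually_dproj_comp_dbranch z).self_of_nhds _

/-- This is the identity `[f z, b] = [z, 1]` in `L_b`, read through `dπ_{f z} ∘ df = dπ_z`. -/
theorem vectorField_contraction (z : PuncturedSpace n) :
    (F.b : ℂ) • F.vectorField (D.contraction z) = D.diag (F.vectorField z) := by
  apply D.dproj_injective
  rw [map_smul, dproj_vectorField, ← val_smul]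
  have h1 := D.lineMk_contraction F.b z 1
  rw [mul_one] at h1
  rw [h1, ← dproj_vectorField, ← D.dproj_contraction z]
  rfl

/-- The definition uses a branch that moves with `z`. Near `a` the fixed branch through `a` gives
the same vector, so the field is locally the morphism followed by the tangent map of one holomorphic
branch. -/
theorem contMDiff_vectorField :
    ContMDiff 𝓘(ℂ, Fin n → ℂ) 𝓘(ℂ, Fin n → ℂ) ω F.vectorField := by
  intro a
  have hM1 : IsManifold 𝓘(ℂ, Fin n → ℂ) 1 D.HopfManifold := IsManifold.of_le (n := ω) le_top
  have hF : ContMDiffAt 𝓘(ℂ, Fin n → ℂ) 𝓘(ℂ, Fin n → ℂ).tangent ω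
      (fun z => (⟨D.proj z, F.val (D.lineMk F.b z 1)⟩ :
        TangentBundle 𝓘(ℂ, Fin n → ℂ) D.HopfManifold)) a :=
    (F.holomorphic.comp (D.contMDiff_lineMk F.b 1)) a
  have hT := (D.contMDiffOn_branch a).contMDiffOn_tangentMapWithin (m := ω) le_top
    (D.isOpen_branchDomain a).uniqueMDiffOn
  have hopen : IsOpen (TotalSpace.proj ⁻¹' D.branchDomain a :
      Set (TangentBundle 𝓘(ℂ, Fin n → ℂ) D.HopfManifold)) :=
    (D.isOpen_branchDomain a).preimage (FiberBundle.continuous_proj _ _)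
  have hTa := hT.contMDiffAt (x := (⟨D.proj a, F.val (D.lineMk F.b a 1)⟩ :
    TangentBundle 𝓘(ℂ, Fin n → ℂ) D.HopfManifold))
    (hopen.mem_nhds (D.eventually_branch_proj a).self_of_nhds.1)
  refine (((contMDiff_snd_tangentBundle_modelSpace (Fin n → ℂ) 𝓘(ℂ, Fin n → ℂ)).contMDiffAt.comp
    _ hTa).comp a hF).congr_of_eventuallyEq ?_
  filter_upwards [D.eventually_branch_proj a, D.eventually_dbranch_comp_dproj a] with z hz hz'
  have h1 : F.vectorField z = D.dbranch a (D.proj z) (F.val (D.lineMk F.b z 1)) := by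
    rw [← dproj_vectorField]
    exact (DFunLike.congr_fun hz' _).symm
  have h2 := mfderivWithin_of_isOpen (I := 𝓘(ℂ, Fin n → ℂ)) (I' := 𝓘(ℂ, Fin n → ℂ))
    (f := D.branch a) (D.isOpen_branchDomain a) hz.1
  rw [h1]
  exact (congrArg (fun A : (Fin n → ℂ) →L[ℂ] (Fin n → ℂ) => A (F.val (D.lineMk F.b z 1))) h2).symm

/-- The vector field inducing the foliation, as a function on `ℂⁿ`, with value `0` at `0`. -/
def vectorFieldExt (z : Fin n → ℂ) : Fin n → ℂ := by
  classical exact if h : z ≠ 0 then F.vectorField ⟨z, h⟩ else 0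

theorem vectorFieldExt_coe (z : PuncturedSpace n) : F.vectorFieldExt z.1 = F.vectorField z := by
  have : z.1 ≠ 0 := z.2
  simp [vectorFieldExt, this]

theorem differentiableOn_vectorFieldExt : DifferentiableOn ℂ F.vectorFieldExt {0}ᶜ := by
  intro z hz
  have h := F.contMDiff_vectorField ⟨z, hz⟩
  have h1 : F.vectorField = fun x : PuncturedSpace n => F.vectorFieldExt x.1 :=
    funext fun x => (F.vectorFieldExt_coe x).symm
  rw [h1, contMDiffAt_subtype_iff, contMDiffAt_iff_contDiffAt] at h
  exact (h.differentiableAt (by simp)).differentiableWithinAt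

theorem exists_vectorField_ne_zero : ∃ z, F.vectorField z ≠ 0 := by
  obtain ⟨ℓ, hℓ⟩ := F.nontrivial
  obtain ⟨⟨z, v⟩, rfl⟩ := CyclicQuotient.mk_surjective _ ℓ
  refine ⟨z, fun h => hℓ ?_⟩
  have h1 := F.val_smul z v
  rw [← dproj_vectorField, h, map_zero, smul_zero] at h1
  exact h1

end Foliation

end HopfData

end HopfFoliation

theorem theorem2 (n : ℕ) (hn : 3 ≤ n) (D : HopfFoliation.HopfData n) (hD : D.IsGeneric)
    (F : D.Foliation) :
    ∃ V : (Fin n → ℂ) → (Fin n → ℂ), HopfFoliation.IsMonomialVectorField V ∧ F.IsInducedBy V := by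
  obtain ⟨V, hV, hVF⟩ := hD.isMonomialVectorField (by omega) F.differentiableOn_vectorFieldExt
    F.b.ne_zero (fun z hz k => by
      have h := congrFun (F.vectorField_contraction ⟨z, hz⟩) k
      rw [← F.vectorFieldExt_coe, ← F.vectorFieldExt_coe] at h
      exact h)
    (by
      obtain ⟨z, hz⟩ := F.exists_vectorField_ne_zero
      exact ⟨z.1, z.2, by rwa [F.vectorFieldExt_coe]⟩)
  refine ⟨V, hV, fun z v => ?_⟩
  rw [hVF z.1 z.2, F.vectorFieldExt_coe]
  refine (F.val_smul z v).trans ?_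
  rw [← F.dproj_vectorField]
  rfl
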